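/- All graphs are finite and simple. For a graph $G$ and a vertex $v$, let $N[v]$ denote the closed neighbourhood of $v$, that is, $v$ together with its neighbours. A function $f : V(G) \to \{-1,1\}$ is called *excellent* if $\sum_{u \in N[v]} f(u) \ge 1$ for every vertex $v$ of $G$. The *excellent decision number* $\overline{\gamma}(G)$ is the minimum of $\sum_{v \in V(G)} f(v)$ over all excellent functions $f$ on $G$. **Theorem.** Let $G$ be a cubic (that is, $3$-regular) graph of order $n$, no connected component of which is isomorphic to the Petersen graph. Then $$\overline{\gamma}(G) \le \frac{3n}{4}.$$ In particular, this holds for every connected cubic graph other than the Petersen graph. -/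

import Mathlib

namespace SimpleGraph

/-- The Petersen graph: its vertices are the 2-element subsets of a 5-element set, two of them
being adjacent when they are disjoint. -/
def petersenGraph : SimpleGraph {s : Finset (Fin 5) // s.card = 2} where
  Adj s t := Disjoint s.1 t.1
  symm := ⟨fun _ _ h => h.symm⟩
  loopless := ⟨fun s h => by
    have h0 : s.1 = ∅ := by simpa using h
    have h2 := s.2
    simp [h0] at h2⟩

variable {V : Type*} [Fintype V] [DecidableEq V]

/-- The closed neighbourhood `N[v] = {v} ∪ N(v)`. -/
def closedNeighborFinset (G : SimpleGraph V) [DecidableRel G.Adj] (v : V) : Finset V :=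
  insert v (G.neighborFinset v)

/-- An excellent function: a function `f : V(G) → {-1, 1}` such that `f(N[v]) ≥ 1` for every
vertex `v`, where `f(S)` is the sum of `f` over `S`. -/
def IsExcellent (G : SimpleGraph V) [DecidableRel G.Adj] (f : V → ℤ) : Prop :=
  (∀ v, f v = -1 ∨ f v = 1) ∧ ∀ v, 1 ≤ ∑ u ∈ G.closedNeighborFinset v, f u

/-- The excellent decision number: the minimum of `f(V(G))` over all excellent functions `f`.
The minimum is attained, see `isLeast_excellentDecisionNumber`. -/
noncomputable def excellentDecisionNumber (G : SimpleGraph V) [DecidableRel G.Adj] : ℤ :=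
  sInf {w : ℤ | ∃ f : V → ℤ, G.IsExcellent f ∧ ∑ v, f v = w}

theorem isLeast_excellentDecisionNumber (G : SimpleGraph V) [DecidableRel G.Adj] :
    IsLeast {w : ℤ | ∃ f : V → ℤ, G.IsExcellent f ∧ ∑ v, f v = w} G.excellentDecisionNumber := by
  have hne : {w : ℤ | ∃ f : V → ℤ, G.IsExcellent f ∧ ∑ v, f v = w}.Nonempty := by
    refine ⟨_, fun _ => 1, ⟨fun _ => Or.inr rfl, fun v => ?_⟩, rfl⟩
    have h : 0 < (G.closedNeighborFinset v).card :=
      Finset.card_pos.mpr ⟨v, Finset.mem_insert_self _ _⟩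
    simp only [Finset.sum_const, nsmul_eq_mul, mul_one]
    exact_mod_cast h
  have hbdd : BddBelow {w : ℤ | ∃ f : V → ℤ, G.IsExcellent f ∧ ∑ v, f v = w} := by
    refine ⟨∑ _v : V, (-1), ?_⟩
    rintro w ⟨f, hf, rfl⟩
    exact Finset.sum_le_sum fun v _ => by rcases hf.1 v with h | h <;> omega
  exact ⟨Int.csInf_mem hne hbdd, fun w hw => csInf_le hbdd hw⟩

end SimpleGraph

set_option linter.unusedSectionVars false

namespace SimpleGraph

/-! ### Nearness, 2-packings and their covers -/

variable {V : Type*} [Fintype V] [DecidableEq V]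

/-! Near means at distance at most 2, so a closed neighbourhood meets a 2-packing `S` at most once.
Putting -1 on `S` and 1 elsewhere gives closed neighbourhoods sum at least 4 - 2 and total weight n
- 2|S|. It therefore suffices to find a 2-packing with n ≤ 8|S|, one component at a time.

In a connected cubic graph a ball of radius 2 has at most 10 vertices. A vertex added just outside
the cover has at least 2 of them covered already, so greedy growth costs at most 8 per vertex
(`exists_isTwoPacking_extension`). If some nonempty packing covers at most 8|S| + 1 vertices,
growing it gives n ≤ 8|T| + 1, and n is even.

Otherwise `HasLargeCovers` holds: balls have exactly 10 vertices, so there are no triangles or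
4-cycles, and balls of non-near vertices share at most 2 vertices. Unless some ball is everything,
`exists_isShortPath` gives a short path; short paths propagate and again make a ball everything.
Then n = 10 with diameter at most 2, which forces the Petersen graph. -/

/-- Two vertices are near when some closed neighbourhood contains both of them. -/
def Near (G : SimpleGraph V) (u v : V) : Prop :=
  u = v ∨ G.Adj u v ∨ ∃ z, G.Adj u z ∧ G.Adj z v

theorem Near.symm {G : SimpleGraph V} {u v : V} (h : G.Near u v) : G.Near v u := by
  rcases h with h | h | ⟨z, h1, h2⟩
  · exact Or.inl h.symm
  · exact Or.inr (Or.inl h.symm)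
  · exact Or.inr (Or.inr ⟨z, h2.symm, h1.symm⟩)

theorem near_self (G : SimpleGraph V) (u : V) : G.Near u u := Or.inl rfl

theorem Adj.near {G : SimpleGraph V} {u v : V} (h : G.Adj u v) : G.Near u v := Or.inr (Or.inl h)

theorem Adj.near_of_adj {G : SimpleGraph V} {u v w : V} (h : G.Adj u v) (h' : G.Adj v w) :
    G.Near u w := Or.inr (Or.inr ⟨v, h, h'⟩)

open Classical in
/-- The vertices near `v`. -/
noncomputable def ballTwo (G : SimpleGraph V) (v : V) : Finset V := {u | G.Near v u}

theorem mem_ballTwo {G : SimpleGraph V} {u v : V} : u ∈ G.ballTwo v ↔ G.Near v u := by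
  simp [ballTwo]

/-- A 2-packing: a set of vertices no two of which are near. -/
def IsTwoPacking (G : SimpleGraph V) (S : Finset V) : Prop :=
  ∀ u ∈ S, ∀ v ∈ S, G.Near u v → u = v

/-- The vertices near some member of `S`. -/
noncomputable def cover (G : SimpleGraph V) (S : Finset V) : Finset V := S.biUnion G.ballTwo

theorem mem_cover {G : SimpleGraph V} {S : Finset V} {u : V} :
    u ∈ G.cover S ↔ ∃ s ∈ S, G.Near s u := by
  simp [cover, mem_ballTwo]

theorem cover_insert (G : SimpleGraph V) (S : Finset V) (y : V) :
    G.cover (insert y S) = G.ballTwo y ∪ G.cover S := by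
  simp [cover, Finset.biUnion_insert]

theorem cover_singleton (G : SimpleGraph V) (y : V) : G.cover {y} = G.ballTwo y := by
  simp [cover]

theorem isTwoPacking_singleton (G : SimpleGraph V) (y : V) : G.IsTwoPacking {y} := by
  intro u hu v hv _
  rw [Finset.mem_singleton] at hu hv
  rw [hu, hv]

theorem IsTwoPacking.insert {G : SimpleGraph V} {S : Finset V} {y : V} (hS : G.IsTwoPacking S)
    (hy : y ∉ G.cover S) : G.IsTwoPacking (insert y S) := by
  rw [mem_cover] at hy
  push Not at hy
  intro u hu v hv h
  rw [Finset.mem_insert] at hu hv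
  rcases hu with rfl | hu <;> rcases hv with rfl | hv
  · rfl
  · exact absurd h.symm (hy v hv)
  · exact absurd h (hy u hu)
  · exact hS u hu v hv h

theorem notMem_of_notMem_cover {G : SimpleGraph V} {S : Finset V} {y : V}
    (hy : y ∉ G.cover S) : y ∉ S := fun h => hy (mem_cover.2 ⟨y, h, G.near_self y⟩)

/-! ### Ball sizes and greedy extension -/

section Regular

variable {G : SimpleGraph V} [DecidableRel G.Adj]

theorem ballTwo_subset (v : V) :
    G.ballTwo v ⊆ insert v (G.neighborFinset v) ∪
      (G.neighborFinset v).biUnion fun a => (G.neighborFinset a).erase v := by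
  intro u hu
  rw [mem_ballTwo] at hu
  by_cases huv : u = v
  · simp [huv]
  rcases hu with h | h | ⟨z, h1, h2⟩
  · exact absurd h.symm huv
  · simp [h]
  · simp only [Finset.mem_union, Finset.mem_biUnion, mem_neighborFinset, Finset.mem_erase]
    exact Or.inr ⟨z, h1, huv, h2⟩

theorem card_neighborFinset_erase (hG : G.IsRegularOfDegree 3) {v a : V} (h : G.Adj v a) :
    ((G.neighborFinset a).erase v).card = 2 := by
  rw [Finset.card_erase_of_mem (by simpa using h.symm), card_neighborFinset_eq_degree, hG]

theorem card_closedNeighborFinset (hG : G.IsRegularOfDegree 3) (v : V) :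
    (insert v (G.neighborFinset v)).card = 4 := by
  rw [Finset.card_insert_of_notMem (by simp), card_neighborFinset_eq_degree, hG]

theorem card_ballTwo_le (hG : G.IsRegularOfDegree 3) (v : V) : (G.ballTwo v).card ≤ 10 := by
  refine (Finset.card_le_card (ballTwo_subset v)).trans ((Finset.card_union_le _ _).trans ?_)
  have h1 := card_closedNeighborFinset hG v
  have h2 := Finset.card_biUnion_le_card_mul (G.neighborFinset v)
    (fun a => (G.neighborFinset a).erase v) 2
    (fun a ha => (card_neighborFinset_erase hG (by simpa using ha)).le)
  rw [card_neighborFinset_eq_degree, hG] at h2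
  omega

/-- The count 1 + 3 + 6 loses one, because a triangle or 4-cycle through `v` reaches `b` a second
time. -/
theorem card_ballTwo_le_nine (hG : G.IsRegularOfDegree 3) {v a b : V} (hva : G.Adj v a)
    (hab : G.Adj a b) (hbv : b ≠ v) (h : G.Adj v b ∨ ∃ c, c ≠ a ∧ G.Adj v c ∧ G.Adj c b) :
    (G.ballTwo v).card ≤ 9 := by
  have hsub : G.ballTwo v ⊆ insert v (G.neighborFinset v) ∪
      (((G.neighborFinset v).erase a).biUnion (fun a => (G.neighborFinset a).erase v) ∪
        ((G.neighborFinset a).erase v).erase b) := by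
    intro u hu
    have hu' := ballTwo_subset v hu
    simp only [Finset.mem_union, Finset.mem_biUnion, mem_neighborFinset, Finset.mem_erase,
      Finset.mem_insert] at hu' ⊢
    by_cases hub : u = b
    · subst hub
      rcases h with h | ⟨c, hca, hvc, hcb⟩
      · exact Or.inl (Or.inr h)
      · exact Or.inr (Or.inl ⟨c, ⟨hca, hvc⟩, hbv, hcb⟩)
    · rcases hu' with hu' | ⟨z, hz, huv, hzu⟩
      · exact Or.inl hu'
      · by_cases hza : z = a
        · subst hza
          exact Or.inr (Or.inr ⟨hub, huv, hzu⟩)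
        · exact Or.inr (Or.inl ⟨z, ⟨hza, hz⟩, huv, hzu⟩)
  refine (Finset.card_le_card hsub).trans ((Finset.card_union_le _ _).trans ?_)
  have h1 := card_closedNeighborFinset hG v
  have h2 := Finset.card_biUnion_le_card_mul ((G.neighborFinset v).erase a)
    (fun a => (G.neighborFinset a).erase v) 2
    (fun a ha => (card_neighborFinset_erase hG
      (by simpa using Finset.mem_of_mem_erase ha)).le)
  rw [card_neighborFinset_erase hG hva.symm] at h2
  have h3 : (((G.neighborFinset a).erase v).erase b).card = 1 := by
    rw [Finset.card_erase_of_mem (by simp [hbv, hab]), card_neighborFinset_erase hG hva]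
  have h4 := Finset.card_union_le
    (((G.neighborFinset v).erase a).biUnion (fun a => (G.neighborFinset a).erase v))
    (((G.neighborFinset a).erase v).erase b)
  omega

theorem exists_adj_ne_ne (hG : G.IsRegularOfDegree 3) (b x y : V) :
    ∃ c, G.Adj b c ∧ c ≠ x ∧ c ≠ y := by
  have h : ((G.neighborFinset b) \ {x, y}).Nonempty := by
    rw [← Finset.card_pos]
    have h1 := Finset.le_card_sdiff {x, y} (G.neighborFinset b)
    have h2 := Finset.card_le_two (a := x) (b := y)
    rw [card_neighborFinset_eq_degree, hG] at h1
    omega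
  obtain ⟨c, hc⟩ := h
  simp only [Finset.mem_sdiff, mem_neighborFinset, Finset.mem_insert, Finset.mem_singleton,
    not_or] at hc
  exact ⟨c, hc.1, hc.2.1, hc.2.2⟩

theorem exists_boundary_of_ne_univ (hconn : G.Connected) {R : Finset V} (hne : R.Nonempty)
    (hR : R ≠ Finset.univ) : ∃ b ∈ R, ∃ y ∉ R, G.Adj b y := by
  obtain ⟨r, hr⟩ := hne
  by_contra! hcon
  refine hR (Finset.eq_univ_iff_forall.2 fun x => ?_)
  obtain ⟨w⟩ := hconn.preconnected r x
  induction w with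
  | nil => exact hr
  | cons h _ ih =>
    refine ih ?_
    by_contra hv
    exact hcon _ hr _ hv h

/-- A vertex outside the cover adjacent to `b` in the cover: two steps lead back to the packing. -/
theorem exists_step_of_boundary {S : Finset V} {b y : V} (hb : b ∈ G.cover S)
    (hy : y ∉ G.cover S) (hby : G.Adj b y) :
    ∃ a ∈ G.cover S, G.Adj a b ∧ a ≠ b ∧ a ≠ y := by
  obtain ⟨p, hp, hpb⟩ := mem_cover.1 hb
  have hpy : ¬ G.Near p y := fun h => hy (mem_cover.2 ⟨p, hp, h⟩)
  rcases hpb with rfl | h | ⟨a, h1, h2⟩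
  · exact absurd hby.near hpy
  · exact absurd (h.near_of_adj hby) hpy
  · refine ⟨a, mem_cover.2 ⟨p, hp, h1.near⟩, h2, h2.ne, ?_⟩
    rintro rfl
    exact hpy h1.near

theorem card_ballTwo_inter_add {S : Finset V} {y : V} :
    (G.cover (insert y S)).card + (G.ballTwo y ∩ G.cover S).card =
      (G.ballTwo y).card + (G.cover S).card := by
  rw [cover_insert, Finset.card_union_add_card_inter]

/-- Of the at most 10 vertices near `y`, both `b` and the vertex before it on a path from the
packing are already covered. -/
theorem card_cover_insert_le (hG : G.IsRegularOfDegree 3) {S : Finset V} {b y : V}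
    (hb : b ∈ G.cover S) (hy : y ∉ G.cover S) (hby : G.Adj b y) :
    (G.cover (insert y S)).card ≤ (G.cover S).card + 8 := by
  obtain ⟨a, ha, hab, hne, -⟩ := exists_step_of_boundary hb hy hby
  have h1 : ({a, b} : Finset V) ⊆ G.ballTwo y ∩ G.cover S := by
    intro z hz
    rw [Finset.mem_insert, Finset.mem_singleton] at hz
    rw [Finset.mem_inter, mem_ballTwo]
    rcases hz with rfl | rfl
    · exact ⟨hby.symm.near_of_adj hab.symm, ha⟩
    · exact ⟨hby.symm.near, hb⟩
  have h2 := Finset.card_le_card h1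
  rw [Finset.card_pair hne] at h2
  have h3 := card_ballTwo_inter_add (G := G) (S := S) (y := y)
  have h4 := card_ballTwo_le hG y
  omega

theorem cover_nonempty {S : Finset V} (hS : S.Nonempty) : (G.cover S).Nonempty := by
  obtain ⟨s, hs⟩ := hS
  exact ⟨s, mem_cover.2 ⟨s, hs, G.near_self s⟩⟩

theorem exists_isTwoPacking_extension (hG : G.IsRegularOfDegree 3) (hconn : G.Connected)
    (S : Finset V) (hne : S.Nonempty) (hS : G.IsTwoPacking S) :
    ∃ T, G.IsTwoPacking T ∧ Fintype.card V + 8 * S.card ≤ 8 * T.card + (G.cover S).card := by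
  by_cases hR : G.cover S = Finset.univ
  · exact ⟨S, hS, by rw [hR, Finset.card_univ]; omega⟩
  obtain ⟨b, hb, y, hy, hby⟩ := exists_boundary_of_ne_univ hconn (cover_nonempty hne) hR
  have hyS := notMem_of_notMem_cover hy
  have hle := card_cover_insert_le hG hb hy hby
  have hcard := Finset.card_insert_of_notMem hyS
  obtain ⟨T, hT, h⟩ := exists_isTwoPacking_extension hG hconn (insert y S)
    (Finset.insert_nonempty y S) (hS.insert hy)
  exact ⟨T, hT, by omega⟩
termination_by Fintype.card V - S.card
decreasing_by
  have := Finset.card_le_univ (insert y S)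
  omega

end Regular

/-! ### Rigidity of graphs with large covers -/

/-- Every nonempty 2-packing `S` covers at least `8|S| + 2` vertices. -/
def HasLargeCovers (G : SimpleGraph V) : Prop :=
  ∀ S : Finset V, S.Nonempty → G.IsTwoPacking S → 8 * S.card + 2 ≤ (G.cover S).card

section LargeCovers

variable {G : SimpleGraph V} [DecidableRel G.Adj]

theorem HasLargeCovers.card_ballTwo (h : G.HasLargeCovers) (hG : G.IsRegularOfDegree 3) (v : V) :
    (G.ballTwo v).card = 10 := by
  have h1 := h {v} (Finset.singleton_nonempty v) (G.isTwoPacking_singleton v)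
  rw [cover_singleton, Finset.card_singleton] at h1
  exact le_antisymm (card_ballTwo_le hG v) h1

theorem not_triangle (h : G.HasLargeCovers) (hG : G.IsRegularOfDegree 3) {a b c : V}
    (hab : G.Adj a b) (hbc : G.Adj b c) : ¬ G.Adj a c := by
  intro hac
  have h1 := card_ballTwo_le_nine hG hab hbc hac.ne' (Or.inl hac)
  have h2 := h.card_ballTwo hG a
  omega

theorem eq_of_square (h : G.HasLargeCovers) (hG : G.IsRegularOfDegree 3) {a b c d : V}
    (hab : G.Adj a b) (hbc : G.Adj b c) (hcd : G.Adj c d) (hda : G.Adj d a) (hac : a ≠ c) :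
    b = d := by
  by_contra hbd
  have h1 := card_ballTwo_le_nine hG hab hbc hac.symm
    (Or.inr ⟨d, fun e => hbd e.symm, hda.symm, hcd.symm⟩)
  have h2 := h.card_ballTwo hG a
  omega

/-- The pair `{u, v}` is a 2-packing, so two balls of size 10 have union at least 18. -/
theorem card_ballTwo_inter_le (h : G.HasLargeCovers) (hG : G.IsRegularOfDegree 3) {u v : V}
    (huv : ¬ G.Near u v) : (G.ballTwo v ∩ G.ballTwo u).card ≤ 2 := by
  have hv : v ∉ G.cover {u} := by rwa [cover_singleton, mem_ballTwo]
  have h1 := h (insert v {u}) (Finset.insert_nonempty _ _)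
    ((G.isTwoPacking_singleton u).insert hv)
  have h2 := card_ballTwo_inter_add (G := G) (S := {u}) (y := v)
  rw [Finset.card_insert_of_notMem (notMem_of_notMem_cover hv), Finset.card_singleton] at h1
  rw [cover_singleton, h.card_ballTwo hG, h.card_ballTwo hG] at h2
  omega

/-- If one extension of the path `v, a, b` ends near `v`, so does every other one. -/
theorem near_of_near (h : G.HasLargeCovers) (hG : G.IsRegularOfDegree 3) {v a b x c : V}
    (hva : G.Adj v a) (hab : G.Adj a b) (hbx : G.Adj b x) (hxa : x ≠ a) (hvx : G.Near v x)
    (hbc : G.Adj b c) : G.Near v c := by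
  by_contra hvc
  have hac : a ≠ c := fun e => hvc (e ▸ hva.near)
  have hxc : x ≠ c := fun e => hvc (e ▸ hvx)
  -- Three common vertices are one too many for the balls of non-near vertices.
  have h1 : ({a, b, x} : Finset V) ⊆ G.ballTwo c ∩ G.ballTwo v := by
    intro z hz
    rw [Finset.mem_insert, Finset.mem_insert, Finset.mem_singleton] at hz
    rw [Finset.mem_inter, mem_ballTwo, mem_ballTwo]
    rcases hz with rfl | rfl | rfl
    · exact ⟨hbc.symm.near_of_adj hab.symm, hva.near⟩
    · exact ⟨hbc.symm.near, hva.near_of_adj hab⟩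
    · exact ⟨hbc.symm.near_of_adj hbx, hvx⟩
  have h2 := Finset.card_le_card h1
  rw [Finset.card_eq_three.2 ⟨a, b, x, hab.ne, hxa.symm, hbx.ne, rfl⟩] at h2
  have h3 := card_ballTwo_inter_le h hG hvc
  omega

/-- The path `v, a, b` is such that all neighbours of `b` are near `v`. -/
structure IsShortPath (G : SimpleGraph V) (v a b : V) : Prop where
  adj_left : G.Adj v a
  adj_right : G.Adj a b
  ne : v ≠ b
  near : ∀ c, G.Adj b c → G.Near v c

/-- Without triangles and 4-cycles, `v` and `x` can only be near through a new vertex `z`, closing a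
5-cycle `v, a, b, x, z`. This cycle lets shortness move along it. -/
theorem IsShortPath.exists_common (h : G.HasLargeCovers) (hG : G.IsRegularOfDegree 3)
    {v a b x : V} (hs : G.IsShortPath v a b) (hbx : G.Adj b x) (hxa : x ≠ a) :
    ∃ z, G.Adj v z ∧ G.Adj z x ∧ z ≠ b ∧ z ≠ a := by
  rcases hs.near x hbx with rfl | h1 | ⟨z, h1, h2⟩
  · exact absurd hbx.symm (not_triangle h hG hs.adj_left hs.adj_right)
  · exact absurd (eq_of_square h hG hs.adj_left hs.adj_right hbx h1.symm hs.ne) hxa.symm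
  · refine ⟨z, h1, h2, ?_, ?_⟩
    · rintro rfl
      exact not_triangle h hG hs.adj_left hs.adj_right h1
    · rintro rfl
      exact not_triangle h hG hs.adj_right hbx h2

theorem IsShortPath.forward (h : G.HasLargeCovers) (hG : G.IsRegularOfDegree 3)
    {v a b x : V} (hs : G.IsShortPath v a b) (hbx : G.Adj b x) (hxa : x ≠ a) :
    G.IsShortPath a b x := by
  obtain ⟨z, hvz, hzx, hzb, -⟩ := hs.exists_common h hG hbx hxa
  exact ⟨hs.adj_right, hbx, hxa.symm, fun c hc => near_of_near h hG hs.adj_right hbx hzx.symm hzb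
    (hs.adj_left.symm.near_of_adj hvz) hc⟩

theorem IsShortPath.reverse (h : G.HasLargeCovers) (hG : G.IsRegularOfDegree 3)
    {v a b : V} (hs : G.IsShortPath v a b) : G.IsShortPath b a v := by
  obtain ⟨x, hbx, hxa, -⟩ := exists_adj_ne_ne hG b a a
  obtain ⟨z, hvz, hzx, -, hza⟩ := hs.exists_common h hG hbx hxa
  exact ⟨hs.adj_right.symm, hs.adj_left.symm, hs.ne.symm, fun c hc => near_of_near h hG
    hs.adj_right.symm hs.adj_left.symm hvz hza (hbx.near_of_adj hzx.symm) hc⟩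

theorem IsShortPath.of_adj (h : G.HasLargeCovers) (hG : G.IsRegularOfDegree 3)
    {v a b w u : V} (hs : G.IsShortPath v a b) (hvw : G.Adj v w) (hwu : G.Adj w u)
    (huv : u ≠ v) : G.IsShortPath v w u := by
  have hr := hs.reverse h hG
  by_cases hwa : w = a
  · subst hwa
    obtain ⟨x, hvx, hxw, -⟩ := exists_adj_ne_ne hG v w w
    exact ((hr.forward h hG hvx hxw).reverse h hG).forward h hG hwu huv
  · exact (hr.forward h hG hvw hwa).forward h hG hwu huv

/-- Every two-edge path from `v` is short by `IsShortPath.of_adj`, so no edge leaves the ball. -/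
theorem IsShortPath.ballTwo_eq_univ (h : G.HasLargeCovers) (hG : G.IsRegularOfDegree 3)
    (hconn : G.Connected) {v a b : V} (hs : G.IsShortPath v a b) :
    G.ballTwo v = Finset.univ := by
  by_contra hne
  obtain ⟨x, hx, y, hy, hxy⟩ := exists_boundary_of_ne_univ hconn
    ⟨v, mem_ballTwo.2 (G.near_self v)⟩ hne
  rw [mem_ballTwo] at hx hy
  rcases hx with rfl | hx | ⟨z, h1, h2⟩
  · exact hy hxy.near
  · exact hy (hx.near_of_adj hxy)
  · by_cases hxv : x = v
    · subst hxv
      exact hy hxy.near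
    · exact hy ((hs.of_adj h hG h1 h2 hxv).near y hxy)

/-- The last step of a greedy packing closes a 5-cycle. -/
theorem exists_isShortPath (h : G.HasLargeCovers) (hG : G.IsRegularOfDegree 3)
    (hconn : G.Connected) (hne : ∀ v, G.ballTwo v ≠ Finset.univ) :
    ∃ v a b, G.IsShortPath v a b := by
  classical
  obtain ⟨v⟩ := hconn.nonempty
  -- A greedy step preserves equality with 8|S| + 2, so from a largest such `S` with incomplete
  -- cover, any boundary step completes the cover and meets the old one in exactly two vertices.
  let P : Finset (Finset V) := {S | S.Nonempty ∧ G.IsTwoPacking S ∧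
    (G.cover S).card = 8 * S.card + 2 ∧ G.cover S ≠ Finset.univ}
  have hP : ∀ S, S ∈ P ↔ S.Nonempty ∧ G.IsTwoPacking S ∧
    (G.cover S).card = 8 * S.card + 2 ∧ G.cover S ≠ Finset.univ := fun S => by simp [P]
  have hPne : P.Nonempty := ⟨{v}, (hP _).2 ⟨Finset.singleton_nonempty v,
    G.isTwoPacking_singleton v, by rw [cover_singleton, h.card_ballTwo hG]; simp,
    by rw [cover_singleton]; exact hne v⟩⟩
  obtain ⟨S, hSP, hmax⟩ := P.exists_max_image Finset.card hPne
  obtain ⟨hSne, hS, hcard, hcov⟩ := (hP S).1 hSP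
  have key : ∀ {b y}, b ∈ G.cover S → y ∉ G.cover S → G.Adj b y →
      (∀ z, z ∉ G.cover S → G.Near y z) ∧
        (∀ c, c ≠ y → G.Adj b c → c ∉ G.cover S ∨ ∀ d, G.Adj b d → d ∈ G.cover S → d = c) ∧
        ∀ c, G.Adj y c → c ∈ G.cover S → c = b := by
    intro b y hb hy hby
    have hyS := notMem_of_notMem_cover hy
    have h1 := card_cover_insert_le hG hb hy hby
    have h2 := h _ (Finset.insert_nonempty y S) (hS.insert hy)
    have h3 := Finset.card_insert_of_notMem hyS
    have h4 := card_ballTwo_inter_add (G := G) (S := S) (y := y)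
    have h5 := h.card_ballTwo hG y
    have huniv : G.cover (insert y S) = Finset.univ := by
      by_contra hcon
      have h6 := hmax (insert y S) ((hP _).2 ⟨Finset.insert_nonempty y S, hS.insert hy,
        by omega, hcon⟩)
      omega
    obtain ⟨a, ha, hab, hne, hay⟩ := exists_step_of_boundary hb hy hby
    have hsub : ({a, b} : Finset V) ⊆ G.ballTwo y ∩ G.cover S := by
      intro z hz
      rw [Finset.mem_insert, Finset.mem_singleton] at hz
      rw [Finset.mem_inter, mem_ballTwo]
      rcases hz with rfl | rfl
      · exact ⟨hby.symm.near_of_adj hab.symm, ha⟩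
      · exact ⟨hby.symm.near, hb⟩
    have heq : ({a, b} : Finset V) = G.ballTwo y ∩ G.cover S :=
      Finset.eq_of_subset_of_card_le hsub (by rw [Finset.card_pair hne]; omega)
    have hmem : ∀ z, G.Near y z → z ∈ G.cover S → z = a ∨ z = b := by
      intro z h1 h2
      have : z ∈ ({a, b} : Finset V) := heq ▸ Finset.mem_inter.2 ⟨mem_ballTwo.2 h1, h2⟩
      simpa using this
    refine ⟨fun z hz => ?_, fun c hcy hbc => ?_, fun c hyc hc => ?_⟩
    · have : z ∈ G.cover (insert y S) := huniv ▸ Finset.mem_univ z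
      rw [cover_insert, Finset.mem_union, mem_ballTwo] at this
      exact this.resolve_right hz
    · by_cases hc : c ∈ G.cover S
      · right
        intro d hbd hd
        have e1 := (hmem c (hby.symm.near_of_adj hbc) hc).resolve_right hbc.ne'
        have e2 := (hmem d (hby.symm.near_of_adj hbd) hd).resolve_right hbd.ne'
        rw [e1, e2]
      · exact Or.inl hc
    · rcases hmem c hyc.near hc with rfl | rfl
      · exact absurd hyc.symm (not_triangle h hG hab hby)
      · rfl
  obtain ⟨b, hb, y, hy, hby⟩ := exists_boundary_of_ne_univ hconn (cover_nonempty hSne) hcov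
  obtain ⟨a, ha, hab, -, hay⟩ := exists_step_of_boundary hb hy hby
  obtain ⟨c, hbc, hca, hcy⟩ := exists_adj_ne_ne hG b a y
  -- The covered neighbour of `b` is `a`, so `c` is a boundary vertex like `y`. Its next neighbour
  -- `d` is then uncovered too, hence near `y`.
  have hc : c ∉ G.cover S := by
    rcases (key hb hy hby).2.1 c hcy hbc with h1 | h1
    · exact h1
    · exact absurd (h1 a hab.symm ha).symm hca
  obtain ⟨d, hcd, hdb, -⟩ := exists_adj_ne_ne hG c b b
  have hd : d ∉ G.cover S := fun hd => hdb ((key hb hc hbc).2.2 d hcd hd)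
  exact ⟨y, b, c, hby.symm, hbc, hcy.symm,
    fun e he => near_of_near h hG hby.symm hbc hcd hdb ((key hb hy hby).1 d hd) he⟩

theorem HasLargeCovers.ballTwo_eq_univ (h : G.HasLargeCovers) (hG : G.IsRegularOfDegree 3)
    (hconn : G.Connected) : (∃ v, G.ballTwo v = Finset.univ) := by
  by_contra! hne
  obtain ⟨v, a, b, hs⟩ := exists_isShortPath h hG hconn hne
  exact hne v (hs.ballTwo_eq_univ h hG hconn)

theorem HasLargeCovers.card_eq (h : G.HasLargeCovers) (hG : G.IsRegularOfDegree 3)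
    (hconn : G.Connected) : Fintype.card V = 10 := by
  obtain ⟨v, hv⟩ := h.ballTwo_eq_univ hG hconn
  rw [← h.card_ballTwo hG v, hv, Finset.card_univ]

theorem HasLargeCovers.near (h : G.HasLargeCovers) (hG : G.IsRegularOfDegree 3)
    (hconn : G.Connected) (u v : V) : G.Near u v := by
  have h1 : G.ballTwo u = Finset.univ := by
    rw [← Finset.card_eq_iff_eq_univ, h.card_ballTwo hG, h.card_eq hG hconn]
  rw [← mem_ballTwo, h1]
  exact Finset.mem_univ v

end LargeCovers

/-! ### Recognising the Petersen graph -/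

section Petersen

/-- The vertices of the Petersen graph: a root, its neighbours, the remaining six vertices. -/
def petersenVertex : Fin 10 → {s : Finset (Fin 5) // s.card = 2} :=
  ![⟨{0, 1}, rfl⟩, ⟨{2, 3}, rfl⟩, ⟨{2, 4}, rfl⟩, ⟨{3, 4}, rfl⟩, ⟨{0, 4}, rfl⟩, ⟨{1, 4}, rfl⟩,
    ⟨{1, 3}, rfl⟩, ⟨{0, 3}, rfl⟩, ⟨{1, 2}, rfl⟩, ⟨{0, 2}, rfl⟩]

/-- The neighbours in the Petersen graph, in the numbering of `petersenVertex`. -/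
def petersenNeighbor : Fin 10 → Fin 3 → Fin 10 :=
  ![![1, 2, 3], ![0, 4, 5], ![0, 6, 7], ![0, 8, 9], ![1, 6, 8], ![1, 7, 9], ![2, 4, 9],
    ![2, 5, 8], ![3, 4, 7], ![3, 5, 6]]

theorem petersenVertex_bijective : Function.Bijective petersenVertex := by
  constructor
  · unfold Function.Injective; decide
  · unfold Function.Surjective; decide

theorem petersenVertex_disjoint_iff (i j : Fin 10) :
    Disjoint (petersenVertex i).1 (petersenVertex j).1 ↔ ∃ k, j = petersenNeighbor i k := by
  revert i j
  decide

theorem petersenNeighbor_injective (i : Fin 10) : Function.Injective (petersenNeighbor i) := by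
  revert i
  unfold Function.Injective
  decide

variable {G : SimpleGraph V} [DecidableRel G.Adj]

/-- Equal sizes make `f` bijective, and 3-regularity means the three tabulated neighbours are all of
them. -/
theorem nonempty_iso_petersenGraph_of_surjective (hG : G.IsRegularOfDegree 3)
    (hV : Fintype.card V = 10) (f : Fin 10 → V) (hf : Function.Surjective f)
    (hadj : ∀ i k, G.Adj (f i) (f (petersenNeighbor i k))) :
    Nonempty (G ≃g petersenGraph) := by
  have hbij : Function.Bijective f :=
    (Fintype.bijective_iff_surjective_and_card f).2 ⟨hf, by simp [hV]⟩
  have hiff : ∀ i j, G.Adj (f i) (f j) ↔ ∃ k, j = petersenNeighbor i k := by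
    intro i j
    constructor
    · intro h
      have himg : Finset.univ.image (fun k => f (petersenNeighbor i k)) =
          G.neighborFinset (f i) := by
        refine Finset.eq_of_subset_of_card_le (fun x hx => ?_) ?_
        · obtain ⟨k, -, rfl⟩ := Finset.mem_image.1 hx
          simpa using hadj i k
        · rw [Finset.card_image_of_injective _ fun _ _ e => petersenNeighbor_injective i (hbij.1 e),
            card_neighborFinset_eq_degree, hG, Finset.card_univ, Fintype.card_fin]
      have hmem : f j ∈ Finset.univ.image (fun k => f (petersenNeighbor i k)) := by
        rw [himg]
        simpa using h
      obtain ⟨k, -, hk⟩ := Finset.mem_image.1 hmem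
      exact ⟨k, (hbij.1 hk).symm⟩
    · rintro ⟨k, rfl⟩
      exact hadj i k
  let e := Equiv.ofBijective f hbij
  let e' := Equiv.ofBijective petersenVertex petersenVertex_bijective
  refine ⟨⟨e.symm.trans e', fun {x y} => ?_⟩⟩
  obtain ⟨i, rfl⟩ := e.surjective x
  obtain ⟨j, rfl⟩ := e.surjective y
  simp only [Equiv.trans_apply, Equiv.symm_apply_apply]
  exact (petersenVertex_disjoint_iff i j).trans (hiff i j).symm

/-- Here `b` and `a'` are at distance exactly 2; a midpoint `v` would give a triangle. -/
theorem exists_adj_of_near (h : G.HasLargeCovers) (hG : G.IsRegularOfDegree 3)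
    (hnear : ∀ u v, G.Near u v) {v a a' b : V} (hva : G.Adj v a) (hva' : G.Adj v a')
    (hne : a ≠ a') (hab : G.Adj a b) (hbv : b ≠ v) : ∃ c, G.Adj a' c ∧ c ≠ v ∧ G.Adj b c := by
  rcases hnear b a' with rfl | h1 | ⟨z, h1, h2⟩
  · exact absurd hva' (not_triangle h hG hva hab)
  · exact absurd (eq_of_square h hG hva hab h1 hva'.symm hbv.symm) hne
  · refine ⟨z, h2.symm, ?_, h1⟩
    rintro rfl
    exact not_triangle h hG hva hab h1.symm

/-- The second neighbours of `v` behind `a'` can be matched with those behind `a`. -/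
theorem exists_matching (h : G.HasLargeCovers) (hG : G.IsRegularOfDegree 3)
    (hnear : ∀ u v, G.Near u v) {v a a' b₀ b₁ : V} (hva : G.Adj v a) (hva' : G.Adj v a')
    (hne : a ≠ a') (hb : (G.neighborFinset a).erase v = {b₀, b₁}) (hb01 : b₀ ≠ b₁) :
    ∃ c₀ c₁, (G.neighborFinset a').erase v = {c₀, c₁} ∧ G.Adj b₀ c₀ ∧ G.Adj b₁ c₁ := by
  have hb0 : b₀ ∈ (G.neighborFinset a).erase v := by simp [hb]
  have hb1 : b₁ ∈ (G.neighborFinset a).erase v := by simp [hb]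
  rw [Finset.mem_erase, mem_neighborFinset] at hb0 hb1
  obtain ⟨c₀, hc0, hc0v, h0⟩ := exists_adj_of_near h hG hnear hva hva' hne hb0.2 hb0.1
  obtain ⟨c₁, hc1, hc1v, h1⟩ := exists_adj_of_near h hG hnear hva hva' hne hb1.2 hb1.1
  refine ⟨c₀, c₁, ?_, h0, h1⟩
  symm
  have hc01 : c₀ ≠ c₁ := by
    rintro rfl
    refine hb01 (eq_of_square h hG hb0.2 h0 h1.symm hb1.2.symm ?_)
    rintro rfl
    exact not_triangle h hG hva hc0.symm hva'
  refine Finset.eq_of_subset_of_card_le (fun x hx => ?_) ?_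
  · rw [Finset.mem_insert, Finset.mem_singleton] at hx
    rcases hx with rfl | rfl <;> simp [*]
  · rw [Finset.card_pair hc01, card_neighborFinset_erase hG hva']

theorem nonempty_iso_petersenGraph (h : G.HasLargeCovers) (hG : G.IsRegularOfDegree 3)
    (hconn : G.Connected) : Nonempty (G ≃g petersenGraph) := by
  have hnear := h.near hG hconn
  have hV := h.card_eq hG hconn
  obtain ⟨v⟩ := hconn.nonempty
  obtain ⟨a₀, a₁, a₂, h01, h02, h12, hN⟩ := Finset.card_eq_three.1
    ((G.card_neighborFinset_eq_degree v).trans (hG v))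
  have hNv : ∀ x, G.Adj v x ↔ x = a₀ ∨ x = a₁ ∨ x = a₂ := fun x => by
    rw [← mem_neighborFinset, hN]; simp
  have ha0 : G.Adj v a₀ := (hNv _).2 (by simp)
  have ha1 : G.Adj v a₁ := (hNv _).2 (by simp)
  have ha2 : G.Adj v a₂ := (hNv _).2 (by simp)
  obtain ⟨b₀, b₁, hb01, hb⟩ := Finset.card_eq_two.1 (card_neighborFinset_erase hG ha0)
  obtain ⟨c₀, c₁, hc, hbc0, hbc1⟩ := exists_matching h hG hnear ha0 ha1 h01 hb hb01
  obtain ⟨d₀, d₁, hd, hbd0, hbd1⟩ := exists_matching h hG hnear ha0 ha2 h02 hb hb01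
  have hmem : ∀ {a x y : V}, (G.neighborFinset a).erase v = {x, y} →
      ∀ z, G.Adj a z → z = v ∨ z = x ∨ z = y := by
    intro a x y hxy z hz
    by_cases hzv : z = v
    · exact Or.inl hzv
    · have : z ∈ (G.neighborFinset a).erase v := by simp [hzv, hz]
      rw [hxy] at this
      simpa [hzv] using this
  have hmem' : ∀ {a x y : V}, (G.neighborFinset a).erase v = {x, y} →
      (G.Adj a x ∧ x ≠ v) ∧ G.Adj a y ∧ y ≠ v := by
    intro a x y hxy
    have hx : x ∈ (G.neighborFinset a).erase v := by simp [hxy]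
    have hy : y ∈ (G.neighborFinset a).erase v := by simp [hxy]
    rw [Finset.mem_erase, mem_neighborFinset] at hx hy
    exact ⟨hx.symm, hy.symm⟩
  obtain ⟨⟨hab0, hb0v⟩, hab1, hb1v⟩ := hmem' hb
  obtain ⟨⟨hac0, hc0v⟩, hac1, hc1v⟩ := hmem' hc
  obtain ⟨⟨had0, hd0v⟩, had1, hd1v⟩ := hmem' hd
  -- The neighbour of `c₀` behind `a₂` cannot be `d₀`, as `b₀, c₀, d₀` would be a triangle; hence
  -- the matching is crossed.
  have hcd0 : G.Adj c₀ d₁ := by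
    obtain ⟨x, hx, hxv, hcx⟩ := exists_adj_of_near h hG hnear ha1 ha2 h12 hac0 hc0v
    rcases hmem hd x hx with rfl | rfl | rfl
    · exact absurd rfl hxv
    · exact absurd hbd0 (not_triangle h hG hbc0 hcx)
    · exact hcx
  have hcd1 : G.Adj c₁ d₀ := by
    obtain ⟨x, hx, hxv, hcx⟩ := exists_adj_of_near h hG hnear ha1 ha2 h12 hac1 hc1v
    rcases hmem hd x hx with rfl | rfl | rfl
    · exact absurd rfl hxv
    · exact hcx
    · exact absurd hbd1 (not_triangle h hG hbc1 hcx)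
  refine nonempty_iso_petersenGraph_of_surjective hG hV
    ![v, a₀, a₁, a₂, b₀, b₁, c₀, c₁, d₀, d₁] (fun x => ?_) ?_
  · rcases hnear v x with rfl | h1 | ⟨z, h1, h2⟩
    · exact ⟨0, rfl⟩
    · rcases (hNv x).1 h1 with rfl | rfl | rfl
      exacts [⟨1, rfl⟩, ⟨2, rfl⟩, ⟨3, rfl⟩]
    · rcases (hNv z).1 h1 with rfl | rfl | rfl
      · rcases hmem hb x h2 with rfl | rfl | rfl
        exacts [⟨0, rfl⟩, ⟨4, rfl⟩, ⟨5, rfl⟩]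
      · rcases hmem hc x h2 with rfl | rfl | rfl
        exacts [⟨0, rfl⟩, ⟨6, rfl⟩, ⟨7, rfl⟩]
      · rcases hmem hd x h2 with rfl | rfl | rfl
        exacts [⟨0, rfl⟩, ⟨8, rfl⟩, ⟨9, rfl⟩]
  · simp only [Fin.forall_fin_succ]
    simp [petersenNeighbor, ha0, ha1, ha2, ha0.symm, ha1.symm, ha2.symm, hab0, hab1, hac0, hac1,
      had0, had1, hab0.symm, hab1.symm, hac0.symm, hac1.symm, had0.symm, had1.symm, hbc0, hbc1,
      hbd0, hbd1, hbc0.symm, hbc1.symm, hbd0.symm, hbd1.symm, hcd0, hcd1, hcd0.symm, hcd1.symm]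

end Petersen

/-! ### Parity, components and the excellent function -/

section Components

theorem even_card_of_isRegularOfDegree_three {G : SimpleGraph V} [DecidableRel G.Adj]
    (hG : G.IsRegularOfDegree 3) : Even (Fintype.card V) := by
  have h := G.sum_degrees_eq_twice_card_edges
  simp only [hG.degree_eq, Finset.sum_const, Finset.card_univ, smul_eq_mul] at h
  rw [Nat.even_iff]
  omega

theorem exists_isTwoPacking_of_connected {G : SimpleGraph V} [DecidableRel G.Adj]
    (hG : G.IsRegularOfDegree 3) (hconn : G.Connected)
    (hP : IsEmpty (G ≃g petersenGraph)) :
    ∃ S, G.IsTwoPacking S ∧ Fintype.card V ≤ 8 * S.card := by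
  have h : ¬ G.HasLargeCovers := fun h =>
    not_isEmpty_iff.2 (nonempty_iso_petersenGraph h hG hconn) hP
  unfold HasLargeCovers at h
  push Not at h
  obtain ⟨S, hne, hS, hlt⟩ := h
  obtain ⟨T, hT, hle⟩ := exists_isTwoPacking_extension hG hconn S hne hS
  -- So far n ≤ 8|T| + 1; parity removes the last unit.
  obtain ⟨m, hm⟩ := even_card_of_isRegularOfDegree_three hG
  exact ⟨T, hT, by omega⟩

theorem exists_isTwoPacking_supp {G : SimpleGraph V} [DecidableRel G.Adj]
    (hG : G.IsRegularOfDegree 3) (c : G.ConnectedComponent)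
    (hP : IsEmpty (c.toSimpleGraph ≃g petersenGraph)) :
    ∃ S : Finset V, (∀ v ∈ S, G.connectedComponentMk v = c) ∧ G.IsTwoPacking S ∧
      ({v | G.connectedComponentMk v = c} : Set V).ncard ≤ 8 * S.card := by
  classical
  have hmem : ∀ u v, G.Adj u v → G.connectedComponentMk u = c → G.connectedComponentMk v = c :=
    fun u v huv hu => (ConnectedComponent.sound huv.reachable).symm.trans hu
  have hdeg : c.toSimpleGraph.IsRegularOfDegree 3 := by
    intro x
    rw [← hG x.1, ← card_neighborFinset_eq_degree, ← card_neighborFinset_eq_degree,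
      ← Finset.card_map (Function.Embedding.subtype _)]
    congr 1
    ext u
    simp only [Finset.mem_map, mem_neighborFinset, Function.Embedding.subtype_apply]
    constructor
    · rintro ⟨y, hy, rfl⟩
      exact hy
    · intro hu
      exact ⟨⟨u, hmem x.1 u hu x.2⟩, hu, rfl⟩
  obtain ⟨S, hS, hcard⟩ := exists_isTwoPacking_of_connected hdeg c.connected_toSimpleGraph hP
  refine ⟨S.map (Function.Embedding.subtype _), ?_, ?_, ?_⟩
  · intro v hv
    obtain ⟨x, -, rfl⟩ := Finset.mem_map.1 hv
    exact x.2
  · intro u hu v hv huv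
    obtain ⟨x, hx, rfl⟩ := Finset.mem_map.1 hu
    obtain ⟨y, hy, rfl⟩ := Finset.mem_map.1 hv
    refine congrArg _ (hS x hx y hy ?_)
    rcases huv with h | h | ⟨z, h1, h2⟩
    · exact Or.inl (Subtype.ext h)
    · exact Or.inr (Or.inl h)
    · exact Or.inr (Or.inr ⟨⟨z, hmem x.1 z h1 x.2⟩, h1, h2⟩)
  · rw [Finset.card_map, ← Nat.card_coe_set_eq]
    rw [← Nat.card_eq_fintype_card] at hcard
    exact hcard

theorem Near.connectedComponentMk_eq {G : SimpleGraph V} {u v : V} (h : G.Near u v) :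
    G.connectedComponentMk u = G.connectedComponentMk v := by
  rcases h with rfl | h | ⟨z, h1, h2⟩
  · rfl
  · exact ConnectedComponent.sound h.reachable
  · exact ConnectedComponent.sound (h1.reachable.trans h2.reachable)

/-- Near vertices share a component, so the union of packings of the components is a packing and the
bounds add up. -/
theorem exists_isTwoPacking {G : SimpleGraph V} [DecidableRel G.Adj]
    (hG : G.IsRegularOfDegree 3)
    (hP : ∀ c : G.ConnectedComponent, IsEmpty (c.toSimpleGraph ≃g petersenGraph)) :
    ∃ S, G.IsTwoPacking S ∧ Fintype.card V ≤ 8 * S.card := by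
  classical
  choose S hmem hS hcard using fun c => exists_isTwoPacking_supp hG c (hP c)
  refine ⟨Finset.univ.biUnion S, ?_, ?_⟩
  · intro u hu v hv huv
    obtain ⟨c, -, hu⟩ := Finset.mem_biUnion.1 hu
    obtain ⟨d, -, hv⟩ := Finset.mem_biUnion.1 hv
    obtain rfl : c = d := by
      rw [← hmem c u hu, ← hmem d v hv, huv.connectedComponentMk_eq]
    exact hS c u hu v hv huv
  · rw [Finset.card_biUnion, Finset.mul_sum, ← Finset.card_univ,
      Finset.card_eq_sum_card_fiberwise (f := G.connectedComponentMk) (t := Finset.univ)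
        (fun _ _ => by simp)]
    · refine Finset.sum_le_sum fun c _ => ?_
      rw [← Set.ncard_coe_finset]
      simpa using hcard c
    · intro c _ d _ hcd
      refine Finset.disjoint_left.2 ?_
      intro x hx hx'
      exact hcd ((hmem c x hx).symm.trans (hmem d x hx'))

/-- The function that is `-1` on a 2-packing and `1` elsewhere is excellent. -/
theorem IsTwoPacking.isExcellent {G : SimpleGraph V} [DecidableRel G.Adj]
    (hG : G.IsRegularOfDegree 3) {S : Finset V} (hS : G.IsTwoPacking S) :
    G.IsExcellent fun v => if v ∈ S then -1 else 1 := by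
  refine ⟨fun v => ?_, fun v => ?_⟩
  · by_cases h : v ∈ S <;> simp [h]
  · have h1 : ((G.closedNeighborFinset v).filter (· ∈ S)).card ≤ 1 := by
      rw [Finset.card_le_one]
      intro x hx y hy
      simp only [closedNeighborFinset, Finset.mem_filter, Finset.mem_insert,
        mem_neighborFinset] at hx hy
      refine hS x hx.2 y hy.2 ?_
      rcases hx.1 with rfl | hx' <;> rcases hy.1 with rfl | hy'
      · exact G.near_self _
      · exact hy'.near
      · exact hx'.symm.near
      · exact hx'.symm.near_of_adj hy'
    have h2 := Finset.card_filter_add_card_filter_not (s := G.closedNeighborFinset v) (· ∈ S)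
    have h3 : (G.closedNeighborFinset v).card = 4 := card_closedNeighborFinset hG v
    rw [Finset.sum_ite, Finset.sum_const, Finset.sum_const]
    simp only [smul_neg, nsmul_eq_mul, mul_one]
    omega

end Components

end SimpleGraph

theorem mainTheorem6 {V : Type*} [Fintype V] [DecidableEq V]
    (G : SimpleGraph V) [DecidableRel G.Adj]
    (hcubic : G.IsRegularOfDegree 3)
    (hPetersen : ∀ c : G.ConnectedComponent,
      IsEmpty (c.toSimpleGraph ≃g SimpleGraph.petersenGraph)) :
    (G.excellentDecisionNumber : ℝ) ≤ 3 * (Fintype.card V : ℝ) / 4 := by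
  obtain ⟨S, hS, hcard⟩ := SimpleGraph.exists_isTwoPacking hcubic hPetersen
  have h1 := G.isLeast_excellentDecisionNumber.2 ⟨_, hS.isExcellent hcubic, rfl⟩
  have h2 := Finset.card_filter_add_card_filter_not (s := (Finset.univ : Finset V)) (· ∈ S)
  rw [Finset.sum_ite, Finset.sum_const, Finset.sum_const] at h1
  simp only [smul_neg, nsmul_eq_mul, mul_one] at h1
  rw [Finset.filter_univ_mem, Finset.card_univ] at h2
  rw [Finset.filter_univ_mem] at h1
  have h3 : 4 * G.excellentDecisionNumber ≤ 3 * (Fintype.card V : ℤ) := by omega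
  have h4 : 4 * (G.excellentDecisionNumber : ℝ) ≤ 3 * (Fintype.card V : ℝ) := by exact_mod_cast h3
  linarith
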